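/- For a real $p\times p$ matrix $Z$ write $\|Z\|_1=\sum_{i,j}|Z_{ij}|$, and call $Z$ $d$-distributed sparse if every row and every column of $Z$ has at most $d$ nonzero entries. The uniformly random $\delta$-left regular bipartite graph with left vertices $1,\dots,p$ and right vertices $1,\dots,m$ is obtained by drawing, for every left vertex $i$, the end points $j_{i,1},\dots,j_{i,\delta}$ of its $\delta$ edges independently and uniformly (with replacement) from $\{1,\dots,m\}$. Its $m\times p$ adjacency matrix $A$ has as entry $A_{ji}$ either the number of indices $k$ with $j_{i,k}=j$ (multiplicities counted), or $1$ if there is such a $k$ and $0$ otherwise; the result below holds for each of these two conventions. There is a constant $\varepsilon\in(0,1/4)$ such that for all $0<a\le b$ there are constants $C,c>0$ and $p_0$ for which the following holds. Let $p\ge p_0$, $d\ge 1$, let $a\log p\le\delta\le b\log p$ and $m\ge C\sqrt{dp}\,\log p$ (so that sizes $\delta=\mathcal O(\log p)$ and $m=\mathcal O(\sqrt{dp}\,\log p)$ suffice), and let $X\in\mathbb R^{p\times p}$ be $d$-distributed sparse. Let $A,B\in\mathbb R^{m\times p}$ be the adjacency matrices of two independent uniformly random $\delta$-left regular bipartite graphs,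 or let $A$ be one such matrix and $B=A$. Then, in either case, with probability exceeding $1-p^{-c}$ the following is true for every $N\in\mathbb R^{p\times p}$: with $\hat X=X+N$, the program $$\min_{\tilde X\in\mathbb R^{p\times p}}\ \|\tilde X\|_1\quad\text{subject to}\quad A\tilde XB^T=A\hat XB^T$$ has a solution, and every solution $X^\ast$ satisfies $$\|X^\ast-X\|_1\le\frac{5-12\varepsilon}{1-4\varepsilon}\,\|N\|_1 .$$ -/

import Mathlib

open MeasureTheory ProbabilityTheory

noncomputable section

namespace Sketching

/-- The entrywise `ℓ₁` norm of a matrix, i.e. the `ℓ₁` norm of its vectorization. -/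
def l1Norm {p : ℕ} (X : Matrix (Fin p) (Fin p) ℝ) : ℝ :=
  ∑ i, ∑ j, |X i j|

/-- A set of index pairs with at most `d` elements in every row and in every column. -/
structure IsDistributed {p : ℕ} (d : ℕ) (S : Finset (Fin p × Fin p)) : Prop where
  row_le : ∀ i : Fin p, (S.filter fun x => x.1 = i).card ≤ d
  col_le : ∀ j : Fin p, (S.filter fun x => x.2 = j).card ≤ d

/-- A matrix is `d`-distributed sparse when its support lies in a set with at most `d` elements
in every row and in every column. -/
def IsDistributedSparse {p : ℕ} (d : ℕ) (X : Matrix (Fin p) (Fin p) ℝ) : Prop :=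
  ∃ S : Finset (Fin p × Fin p), IsDistributed d S ∧ ∀ i j, X i j ≠ 0 → (i, j) ∈ S

/-- `Z` solves: minimize `‖W‖₁` over all matrices `W` with `A W Bᵀ = Y`. -/
def IsL1Solution {p m : ℕ} (A B : Matrix (Fin m) (Fin p) ℝ) (Y : Matrix (Fin m) (Fin m) ℝ)
    (Z : Matrix (Fin p) (Fin p) ℝ) : Prop :=
  A * Z * B.transpose = Y ∧
    ∀ W : Matrix (Fin p) (Fin p) ℝ, A * W * B.transpose = Y → l1Norm Z ≤ l1Norm W

/-- An outcome of the random choice of edges: `J (i, k)` is the right vertex hit by the `k`-th edge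
leaving the left vertex `i`. -/
abbrev EdgeChoice (p m δ : ℕ) : Type := Fin p × Fin δ → Fin m

/-- The law of the uniformly random `δ`-left regular bipartite graph: the end points of the `δ`
edges at each of the `p` left vertices are independent and uniform on the `m` right vertices
(sampling with replacement). -/
def edgeLaw (p m δ : ℕ) : Measure (EdgeChoice p m δ) :=
  Measure.pi fun _ => uniformOn (Set.univ : Set (Fin m))

/-- The `m × p` adjacency matrix in which a repeated edge is counted with its multiplicity. -/
def countMatrix {p m δ : ℕ} (J : EdgeChoice p m δ) : Matrix (Fin m) (Fin p) ℝ :=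
  fun j i => ((Finset.univ.filter fun k : Fin δ => J (i, k) = j).card : ℝ)

open Classical in
/-- The `m × p` adjacency matrix with entries `0` and `1`: repeated edges are merged. -/
def zeroOneMatrix {p m δ : ℕ} (J : EdgeChoice p m δ) : Matrix (Fin m) (Fin p) ℝ :=
  fun j i => if ∃ k : Fin δ, J (i, k) = j then 1 else 0

/-- For every noise matrix `N`, the `ℓ₁` program with data `A (X + N) Bᵀ` has a solution, and every
solution is within `ℓ₁` distance `(5 - 12 ε) / (1 - 4 ε) * ‖N‖₁` of `X`. -/
def NoisyRecovery {p m : ℕ} (ε : ℝ) (A B : Matrix (Fin m) (Fin p) ℝ)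
    (X : Matrix (Fin p) (Fin p) ℝ) : Prop :=
  ∀ N : Matrix (Fin p) (Fin p) ℝ,
    (∃ Z, IsL1Solution A B (A * (X + N) * B.transpose) Z) ∧
    ∀ Z, IsL1Solution A B (A * (X + N) * B.transpose) Z →
      l1Norm (Z - X) ≤ (5 - 12 * ε) / (1 - 4 * ε) * l1Norm N

end Sketching

end

namespace Sketching

/-! View `A Z Bᵀ` as the matrix `A ⊗ B` applied to the vectorization of `Z`. The column of a pair `c
= (i, j)` is carried by δ² pairs of edges. Fix a distributed set Ω containing the support of `X`.
If, for every `c`, at most 9/40 of these edge pairs land where another element of Ω also lands, then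
the columns in Ω are nearly disjoint and kernel elements cannot concentrate on Ω
(`sum_abs_le_of_kernel`); stable recovery follows (`noisyRecovery_of_nullSpace`). Since `X` is fixed
before the graphs are drawn, only this one Ω matters, and a union bound over the p² columns suffices
(`rare_collisions`).

For one column, the δ² edge pairs are built from at most 2δ independent edges, so their end points
are revealed in two rounds, each controlled by `rare_hits` with failure probability ρ^δ
(`rare_pairs`). With `ρ = exp (-4 / a)` this is at most p⁻⁴.

Both cases of the theorem are one argument about a random graph on a left vertex set `V` with
injections `α`, `β` of `Fin p`: independent graphs use the two halves of a disjoint union, and `B =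
A` uses `α = β = id`. All probabilities are proportions, because the law is uniform. -/

/-- The proportion of elements of a finite type with the property `P` is at most `τ`. -/
def Rare {α : Type*} (τ : ℝ) (P : α → Prop) : Prop :=
  ({x | P x}.ncard : ℝ) ≤ τ * (Nat.card α : ℝ)

/-! ### Union bounds for proportions -/

section Rare

variable {α : Type*} {τ σ : ℝ} {P Q : α → Prop}

lemma Rare.mono [Finite α] (h : Rare τ P) (hQ : ∀ x, Q x → P x) : Rare τ Q :=
  le_trans (by exact_mod_cast Set.ncard_le_ncard (fun x hx => hQ x hx) (Set.toFinite _)) h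

lemma Rare.weaken (h : Rare τ P) (hτ : τ ≤ σ) : Rare σ P :=
  le_trans h (mul_le_mul_of_nonneg_right hτ (Nat.cast_nonneg _))

lemma Rare.or (h : Rare τ P) (h' : Rare σ Q) : Rare (τ + σ) fun x => P x ∨ Q x := by
  have : (({x | P x ∨ Q x} : Set α).ncard : ℝ) ≤ {x | P x}.ncard + {x | Q x}.ncard := by
    exact_mod_cast Set.ncard_union_le {x | P x} {x | Q x}
  unfold Rare at *
  linarith

lemma rare_false (hτ : 0 ≤ τ) : Rare τ fun _ : α => False := by
  simp only [Rare, Set.ofPred_false, Set.ncard_empty, Nat.cast_zero]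
  positivity

lemma rare_exists {ι : Type*} [Fintype ι] {P : ι → α → Prop} [Finite α]
    (h : ∀ i, Rare τ (P i)) : Rare (Fintype.card ι * τ) fun x => ∃ i, P i x := by
  classical
  suffices ∀ s : Finset ι, Rare (s.card * τ) fun x => ∃ i ∈ s, P i x by
    simpa [Finset.card_univ] using this Finset.univ
  intro s
  induction s using Finset.induction_on with
  | empty => simpa using rare_false (α := α) le_rfl
  | insert i s hi ih =>
    refine ((h i).or ih).mono (fun x => by simp) |>.weaken ?_
    rw [Finset.card_insert_of_notMem hi]
    push_cast
    linarith

end Rare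

/-! ### Exposing the edges at one or two left vertices -/

section Hits

variable {m δ : ℕ} {V : Type*} [Fintype V] [DecidableEq V]

/-- Exchanging the new value `v` with the old value `J e` is an involution of the pairs `(J, v)`:
resampling one coordinate preserves the uniform law. -/
lemma sum_sum_update {I : Type*} [Fintype I] [DecidableEq I] (e : I) (F : (I → Fin m) → ℝ) :
    ∑ J, ∑ v, F (Function.update J e v) = m * ∑ J, F J := by
  let φ : (I → Fin m) × Fin m → (I → Fin m) × Fin m :=
    fun q => (Function.update q.1 e q.2, q.1 e)
  have hφ : Function.Involutive φ := fun q => by simp [φ]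
  rw [← Fintype.sum_prod_type' fun J v => F (Function.update J e v)]
  calc ∑ q : (I → Fin m) × Fin m, F (Function.update q.1 e q.2)
      = ∑ q, (fun q : (I → Fin m) × Fin m => F q.1) (hφ.toPerm φ q) := rfl
    _ = ∑ q : (I → Fin m) × Fin m, F q.1 := Equiv.sum_comp (hφ.toPerm φ) fun q => F q.1
    _ = m * ∑ J, F J := by
      rw [Fintype.sum_prod_type]
      simp [Finset.mul_sum]

/-- If `H k J` does not depend on the edges `k, k + 1, …` at the vertex `x`, then the events
`J (x, k) ∈ H k J` behave at worst like independent ones. -/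
lemma sum_prod_hits_le {q : ℝ} (hm : 0 < m) (hq : 0 ≤ q) (x : V)
    (H : Fin δ → (V × Fin δ → Fin m) → Finset (Fin m))
    (hH : ∀ k k' J v, k ≤ k' → H k (Function.update J (x, k') v) = H k J)
    (hcard : ∀ k J, ((H k J).card : ℝ) ≤ q * m) (T : Finset (Fin δ)) :
    ∑ J, ∏ k ∈ T, (if J (x, k) ∈ H k J then (1 : ℝ) else 0) ≤
      q ^ T.card * Nat.card (V × Fin δ → Fin m) := by
  -- Removing the largest index first: the remaining factors do not see that edge, so averaging over
  -- it costs a factor `q`.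
  induction T using Finset.induction_on_max with
  | empty => simp
  | insert k s hs ih =>
    have hk : k ∉ s := fun h => lt_irrefl _ (hs k h)
    have hm' : (0 : ℝ) < m := by exact_mod_cast hm
    simp only [Finset.prod_insert hk, Finset.card_insert_of_notMem hk]
    set F : (V × Fin δ → Fin m) → ℝ := fun J => ∏ k ∈ s, if J (x, k) ∈ H k J then (1 : ℝ) else 0
      with hF
    have hF0 : ∀ J, 0 ≤ F J := fun J => Finset.prod_nonneg fun k _ => by split_ifs <;> norm_num
    have hinv : ∀ J v, F (Function.update J (x, k) v) = F J := by
      intro J v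
      refine Finset.prod_congr rfl fun k' hk' => ?_
      rw [hH k' k J v (hs k' hk').le,
        Function.update_of_ne (by simpa using (hs k' hk').ne)]
    have key := sum_sum_update (x, k)
      fun J : V × Fin δ → Fin m => (if J (x, k) ∈ H k J then (1 : ℝ) else 0) * F J
    simp only [hinv, hH k k _ _ le_rfl, Function.update_self] at key
    have h1 : ∀ J, ∑ v, (if v ∈ H k J then (1 : ℝ) else 0) * F J ≤ q * m * F J := by
      intro J
      rw [← Finset.sum_mul, Finset.sum_boole]
      refine mul_le_mul_of_nonneg_right ?_ (hF0 J)
      simpa using hcard k J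
    have h2 := Finset.sum_le_sum fun J (_ : J ∈ Finset.univ) => h1 J
    rw [key, ← Finset.mul_sum] at h2
    have h3 : ∑ J, (if J (x, k) ∈ H k J then (1 : ℝ) else 0) * F J ≤ q * ∑ J, F J := by
      refine le_of_mul_le_mul_left (h2.trans (le_of_eq ?_)) hm'
      ring
    calc _ ≤ q * ∑ J, F J := h3
      _ ≤ q * (q ^ s.card * Nat.card (V × Fin δ → Fin m)) := mul_le_mul_of_nonneg_left ih hq
      _ = _ := by ring

/-- Union bound over the at most 2^δ sets `T` of edges with `δ ≤ N * T.card`. All edges of `T` hit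
with probability at most `(ρ / 2) ^ (N * T.card) ≤ (ρ / 2) ^ δ`; the factor 1/2 absorbs the number
of sets. -/
lemma rare_hits {N : ℕ} {ρ : ℝ} (hm : 0 < m) (hρ : 0 < ρ) (hρ1 : ρ ≤ 1) (x : V)
    (H : Fin δ → (V × Fin δ → Fin m) → Finset (Fin m))
    (hH : ∀ k k' J v, k ≤ k' → H k (Function.update J (x, k') v) = H k J)
    (hcard : ∀ k J, ((H k J).card : ℝ) ≤ (ρ / 2) ^ N * m) :
    Rare (ρ ^ δ) fun J : V × Fin δ → Fin m =>
      δ ≤ N * (Finset.univ.filter fun k => J (x, k) ∈ H k J).card := by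
  classical
  set 𝒯 : Finset (Finset (Fin δ)) := Finset.univ.filter fun T => δ ≤ N * T.card with h𝒯
  set M : ℝ := (Nat.card (V × Fin δ → Fin m) : ℝ)
  have hM : 0 ≤ M := Nat.cast_nonneg _
  have h0 : ∀ (T : Finset (Fin δ)) (J : V × Fin δ → Fin m),
      0 ≤ ∏ k ∈ T, (if J (x, k) ∈ H k J then (1 : ℝ) else 0) :=
    fun T J => Finset.prod_nonneg fun k _ => by split_ifs <;> norm_num
  have h1 : ∀ J : V × Fin δ → Fin m,
      (if δ ≤ N * (Finset.univ.filter fun k => J (x, k) ∈ H k J).card then (1 : ℝ) else 0) ≤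
        ∑ T ∈ 𝒯, ∏ k ∈ T, (if J (x, k) ∈ H k J then (1 : ℝ) else 0) := by
    intro J
    split_ifs with h
    · refine le_trans (le_of_eq ?_) (Finset.single_le_sum (fun T _ => h0 T J)
        (show (Finset.univ.filter fun k => J (x, k) ∈ H k J) ∈ 𝒯 by simpa [h𝒯] using h))
      exact (Finset.prod_eq_one fun k hk => if_pos (Finset.mem_filter.1 hk).2).symm
    · exact Finset.sum_nonneg fun T _ => h0 T J
  have hT : ∀ T ∈ 𝒯, ∑ J, ∏ k ∈ T, (if J (x, k) ∈ H k J then (1 : ℝ) else 0) ≤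
      (ρ / 2) ^ δ * M := by
    intro T hT
    refine (sum_prod_hits_le hm (by positivity) x H hH hcard T).trans
      (mul_le_mul_of_nonneg_right ?_ hM)
    rw [← pow_mul]
    exact pow_le_pow_of_le_one (by positivity) (by linarith) (Finset.mem_filter.1 hT).2
  calc _ = ∑ J : V × Fin δ → Fin m,
        (if δ ≤ N * (Finset.univ.filter fun k => J (x, k) ∈ H k J).card then (1 : ℝ) else 0) := by
        rw [Finset.sum_boole, Set.ncard_eq_toFinset_card', Set.toFinset_ofPred]
    _ ≤ ∑ J, ∑ T ∈ 𝒯, ∏ k ∈ T, (if J (x, k) ∈ H k J then (1 : ℝ) else 0) :=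
        Finset.sum_le_sum fun J _ => h1 J
    _ = ∑ T ∈ 𝒯, ∑ J, ∏ k ∈ T, (if J (x, k) ∈ H k J then (1 : ℝ) else 0) := Finset.sum_comm
    _ ≤ 𝒯.card * ((ρ / 2) ^ δ * M) := by
        simpa using Finset.sum_le_card_nsmul 𝒯 _ _ hT
    _ ≤ 2 ^ δ * ((ρ / 2) ^ δ * M) := by
        refine mul_le_mul_of_nonneg_right ?_ (by positivity)
        have := Finset.card_le_univ 𝒯
        rw [Fintype.card_finset, Fintype.card_fin] at this
        exact_mod_cast this
    _ = ρ ^ δ * M := by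
        rw [← mul_assoc, ← mul_pow]
        congr 2
        ring

/-- A family of sparse relations `G J` that ignores the edges at `x` and `y` relates few pairs of
edges at `x` and `y`; when `x = y` only the pairs in increasing order are counted. -/
lemma rare_pairs {N : ℕ} {ρ : ℝ} (hN : 0 < N) (hm : 0 < m) (hδ : 0 < δ) (hρ : 0 < ρ) (hρ1 : ρ ≤ 1)
    (x y : V) (G : (V × Fin δ → Fin m) → Finset (Fin m × Fin m))
    (hGx : ∀ J k v, G (Function.update J (x, k) v) = G J)
    (hGy : ∀ J k v, G (Function.update J (y, k) v) = G J)
    (hcard : ∀ J, ((G J).card : ℝ) ≤ ((ρ / 2) ^ N) ^ 2 / N * (m : ℝ) ^ 2) :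
    Rare (2 * ρ ^ δ) fun J : V × Fin δ → Fin m =>
      3 * δ ^ 2 < N * (Finset.univ.filter fun e : Fin δ × Fin δ =>
        (x ≠ y ∨ e.1 < e.2) ∧ (J (x, e.1), J (y, e.2)) ∈ G J).card := by
  classical
  set q : ℝ := (ρ / 2) ^ N with hq
  have hq0 : 0 < q := by positivity
  have hm' : (0 : ℝ) < m := by exact_mod_cast hm
  have hN' : (0 : ℝ) < N := by exact_mod_cast hN
  have hδ' : (0 : ℝ) < δ := by exact_mod_cast hδ
  let deg : (V × Fin δ → Fin m) → Fin m → ℕ := fun J u =>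
    (Finset.univ.filter fun v => (u, v) ∈ G J).card
  -- The size of `G J` allows at most `q * m` right vertices of such large degree.
  let heavy : (V × Fin δ → Fin m) → Finset (Fin m) := fun J =>
    Finset.univ.filter fun u => q / N * m ≤ deg J u
  -- Light end points have degree below `q / N * m`, so by double counting at most `q * m` vertices
  -- `v` are related to a fraction `1 / N` of the edges at `x` in this way. For `x = y` the
  -- restriction `k < l` makes this set depend only on edges before `l`, as `rare_hits` requires.
  let cnt : Fin δ → (V × Fin δ → Fin m) → Fin m → ℕ := fun l J v =>
    (Finset.univ.filter fun k => (x ≠ y ∨ k < l) ∧ J (x, k) ∉ heavy J ∧ (J (x, k), v) ∈ G J).card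
  let heavy' : Fin δ → (V × Fin δ → Fin m) → Finset (Fin m) := fun l J =>
    Finset.univ.filter fun v => δ ≤ N * cnt l J v
  have hheavy : ∀ J J', G J = G J' → heavy J = heavy J' := by
    intro J J' h
    simp only [heavy, deg, h]
  have A : Rare (ρ ^ δ) fun J : V × Fin δ → Fin m =>
      δ ≤ N * (Finset.univ.filter fun k => J (x, k) ∈ heavy J).card := by
    refine rare_hits hm hρ hρ1 x (fun _ => heavy) (fun k k' J v _ => hheavy _ _ (hGx J k' v)) ?_
    intro _ J
    have h1 : ((heavy J).card : ℝ) * (q / N * m) ≤ (G J).card := by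
      calc ((heavy J).card : ℝ) * (q / N * m) = ∑ u ∈ heavy J, q / N * m := by simp
        _ ≤ ∑ u ∈ heavy J, (deg J u : ℝ) :=
          Finset.sum_le_sum fun u hu => (Finset.mem_filter.1 hu).2
        _ ≤ ∑ u, (deg J u : ℝ) :=
          Finset.sum_le_sum_of_subset_of_nonneg (Finset.subset_univ _) fun _ _ _ =>
            Nat.cast_nonneg _
        _ = (G J).card := by
          rw [Finset.card_eq_sum_card_fiberwise (f := Prod.fst) (t := Finset.univ)
            (fun _ _ => Finset.mem_univ _)]
          push_cast
          refine Finset.sum_congr rfl fun u _ => ?_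
          congr 1
          refine Finset.card_bij (fun v _ => (u, v)) (by simp) (by simp) ?_
          rintro ⟨u', v⟩ h
          simp only [Finset.mem_filter] at h
          obtain ⟨h, rfl⟩ := h
          exact ⟨v, by simpa using h, rfl⟩
    have h2 : 0 < q / N * m := by positivity
    refine le_of_mul_le_mul_right (h1.trans ((hcard J).trans (le_of_eq ?_))) h2
    rw [← hq]
    ring
  have B : Rare (ρ ^ δ) fun J : V × Fin δ → Fin m =>
      δ ≤ N * (Finset.univ.filter fun l => J (y, l) ∈ heavy' l J).card := by
    refine rare_hits hm hρ hρ1 y heavy' ?_ ?_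
    · intro l l' J v hl
      have : ∀ w, cnt l (Function.update J (y, l') v) w = cnt l J w := by
        intro w
        simp only [cnt]
        congr 1
        refine Finset.filter_congr fun k _ => and_congr_right fun hk => ?_
        rw [hheavy _ _ (hGy J l' v), hGy, Function.update_of_ne]
        rintro h
        obtain ⟨h1, h2⟩ := Prod.ext_iff.1 h
        rcases hk with hk | hk
        · exact hk h1
        · exact absurd hk (not_lt.2 (hl.trans h2.ge))
      simp only [heavy', this]
    · intro l J
      have h1 : ((heavy' l J).card : ℝ) * δ ≤ N * (δ * (q / N * m)) := by
        calc ((heavy' l J).card : ℝ) * δ = ∑ v ∈ heavy' l J, (δ : ℝ) := by simp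
          _ ≤ ∑ v ∈ heavy' l J, (N : ℝ) * cnt l J v :=
            Finset.sum_le_sum fun v hv => by exact_mod_cast (Finset.mem_filter.1 hv).2
          _ ≤ ∑ v, (N : ℝ) * cnt l J v :=
            Finset.sum_le_sum_of_subset_of_nonneg (Finset.subset_univ _) fun _ _ _ => by positivity
          _ = N * ∑ v, (cnt l J v : ℝ) := by rw [Finset.mul_sum]
          _ ≤ N * ∑ k : Fin δ, (q / N * m) := by
            refine mul_le_mul_of_nonneg_left ?_ hN'.le
            simp only [cnt, ← Finset.sum_boole]
            rw [Finset.sum_comm]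
            refine Finset.sum_le_sum fun k _ => ?_
            by_cases hk : J (x, k) ∈ heavy J
            · simp only [hk, not_true_eq_false, false_and, and_false, if_false,
                Finset.sum_const_zero]
              positivity
            · refine le_trans ?_ (le_of_not_ge fun h => hk (Finset.mem_filter.2
                ⟨Finset.mem_univ _, h⟩) : (deg J (J (x, k)) : ℝ) ≤ q / N * m)
              simp only [deg, ← Finset.sum_boole]
              refine Finset.sum_le_sum fun v _ => ?_
              split_ifs with h1 h2
              exacts [le_rfl, absurd h1.2.2 h2, zero_le_one, le_rfl]
          _ = N * (δ * (q / N * m)) := by simp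
      refine le_of_mul_le_mul_right (h1.trans (le_of_eq ?_)) hδ'
      rw [← hq]
      field_simp
  refine ((A.or B).mono ?_).weaken (by linarith)
  intro J hJ
  by_contra hcon
  push Not at hcon
  obtain ⟨hA, hB⟩ := hcon
  refine absurd hJ (not_lt.2 ?_)
  set K := Finset.univ.filter fun k => J (x, k) ∈ heavy J
  set L := Finset.univ.filter fun l => J (y, l) ∈ heavy' l J
  -- The pairs meeting `K`, those meeting `L` and those in `R` each number at most δ² / N, whence
  -- the factor 3.
  set R := Finset.univ.filter fun e : Fin δ × Fin δ => e.2 ∉ L ∧ (x ≠ y ∨ e.1 < e.2) ∧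
    J (x, e.1) ∉ heavy J ∧ (J (x, e.1), J (y, e.2)) ∈ G J with hR
  have hsub : (Finset.univ.filter fun e : Fin δ × Fin δ =>
      (x ≠ y ∨ e.1 < e.2) ∧ (J (x, e.1), J (y, e.2)) ∈ G J) ⊆
      K ×ˢ Finset.univ ∪ Finset.univ ×ˢ L ∪ R := by
    intro e he
    simp only [Finset.mem_filter, Finset.mem_univ, true_and] at he
    simp only [hR, K, L, Finset.mem_union, Finset.mem_product, Finset.mem_filter, Finset.mem_univ,
      true_and, and_true]
    tauto
  have hRcard : N * R.card ≤ δ ^ 2 := by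
    rw [Finset.card_eq_sum_card_fiberwise (f := Prod.snd) (t := Finset.univ)
      (fun _ _ => Finset.mem_univ _), Finset.mul_sum]
    calc _ ≤ ∑ l : Fin δ, δ := by
          refine Finset.sum_le_sum fun l _ => ?_
          by_cases hl : l ∈ L
          · rw [Finset.filter_eq_empty_iff.2]
            · simp
            · rintro e he rfl
              exact (Finset.mem_filter.1 he).2.1 hl
          · have h2 : N * cnt l J (J (y, l)) < δ := by
              by_contra h
              exact hl (Finset.mem_filter.2 ⟨Finset.mem_univ _,
                Finset.mem_filter.2 ⟨Finset.mem_univ _, not_lt.1 h⟩⟩)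
            refine le_trans (Nat.mul_le_mul_left _ ?_) h2.le
            refine Finset.card_le_card_of_injOn Prod.fst ?_ ?_
            · intro e he
              obtain ⟨he', rfl⟩ := Finset.mem_filter.1 he
              exact Finset.mem_filter.2 ⟨Finset.mem_univ _, (Finset.mem_filter.1 he').2.2⟩
            · intro e he e' he' h
              exact Prod.ext h ((Finset.mem_filter.1 he).2.trans (Finset.mem_filter.1 he').2.symm)
      _ = δ ^ 2 := by simp [sq]
  have h3 := (Finset.card_le_card hsub).trans ((Finset.card_union_le _ _).trans
    (Nat.add_le_add_right (Finset.card_union_le _ _) _))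
  simp only [Finset.card_product, Finset.card_univ, Fintype.card_fin] at h3
  nlinarith [Nat.mul_le_mul_left N h3, Nat.mul_le_mul_right δ hA.le, Nat.mul_le_mul_right δ hB.le]

end Hits

/-! ### Collisions with a fixed distributed set -/

section Collisions

variable {m δ p d N : ℕ} {V : Type*} {ρ : ℝ}

open Classical in
/-- The edges at `x` whose end point is also hit by an edge at a vertex of `S`. -/
def hits (S : Finset V) (x : V) (J : V × Fin δ → Fin m) : Finset (Fin δ) :=
  Finset.univ.filter fun k => ∃ x' ∈ S, ∃ k', J (x', k') = J (x, k)

/-- The edges at `x` that repeat an earlier edge at `x`. -/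
def repeats (x : V) (J : V × Fin δ → Fin m) : Finset (Fin δ) :=
  Finset.univ.filter fun k => ∃ k' < k, J (x, k') = J (x, k)

open Classical in
/-- The pairs of edges at `α c.1` and `β c.2` whose pair of end points is also joined to a
pair of vertices coming from another element of `Ω`. -/
def badPairs (α β : Fin p → V) (Ω : Finset (Fin p × Fin p)) (J : V × Fin δ → Fin m)
    (c : Fin p × Fin p) : Finset (Fin δ × Fin δ) :=
  Finset.univ.filter fun e => ∃ c' ∈ Ω, c' ≠ c ∧ (∃ k, J (α c'.1, k) = J (α c.1, e.1)) ∧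
    ∃ l, J (β c'.2, l) = J (β c.2, e.2)

lemma IsDistributed.card_le {Ω : Finset (Fin p × Fin p)} (h : IsDistributed d Ω) :
    Ω.card ≤ p * d := by
  rw [Finset.card_eq_sum_card_fiberwise (f := Prod.fst) (t := Finset.univ)
    (fun _ _ => Finset.mem_univ _)]
  simpa using Finset.sum_le_card_nsmul Finset.univ _ d fun i _ => h.row_le i

variable [Fintype V] [DecidableEq V]

lemma rare_le_hits (hm : 0 < m) (hρ : 0 < ρ) (hρ1 : ρ ≤ 1) {S : Finset V} {x : V} (hx : x ∉ S)
    (hS : S.card ≤ d + 1) (h : ((d : ℝ) + 1) * δ ≤ (ρ / 2) ^ N * m) :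
    Rare (ρ ^ δ) fun J : V × Fin δ → Fin m => δ ≤ N * (hits S x J).card := by
  classical
  refine (rare_hits (N := N) hm hρ hρ1 x (fun _ J => (S ×ˢ Finset.univ).image J) ?_ ?_).mono ?_
  · intro _ k' J v _
    refine Finset.image_congr fun e he => Function.update_of_ne ?_ _ _
    rintro rfl
    exact hx (Finset.mem_product.1 he).1
  · intro _ J
    refine le_trans ?_ h
    have := (Finset.card_image_le (s := S ×ˢ Finset.univ) (f := J)).trans
      (le_of_eq (Finset.card_product _ _))
    rw [Finset.card_univ, Fintype.card_fin] at this
    exact_mod_cast this.trans (Nat.mul_le_mul_right _ hS)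
  · intro J hJ
    refine hJ.trans (Nat.mul_le_mul_left _ (Finset.card_le_card fun k hk => ?_))
    obtain ⟨x', hx', k', hk'⟩ := (Finset.mem_filter.1 hk).2
    exact Finset.mem_filter.2 ⟨Finset.mem_univ _, Finset.mem_image.2 ⟨(x', k'), by simpa, hk'⟩⟩

lemma rare_le_repeats (hm : 0 < m) (hρ : 0 < ρ) (hρ1 : ρ ≤ 1) (x : V)
    (h : ((d : ℝ) + 1) * δ ≤ (ρ / 2) ^ N * m) :
    Rare (ρ ^ δ) fun J : V × Fin δ → Fin m => δ ≤ N * (repeats x J).card := by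
  classical
  refine (rare_hits (N := N) hm hρ hρ1 x
    (fun k J => (Finset.univ.filter (· < k)).image fun k' => J (x, k')) ?_ ?_).mono ?_
  · intro k k' J v hk
    refine Finset.image_congr fun e he => Function.update_of_ne ?_ _ _
    have : e < k := (Finset.mem_filter.1 he).2
    simpa using (this.trans_le hk).ne
  · intro k J
    have h1 := (Finset.card_image_le (s := Finset.univ.filter (· < k))
      (f := fun k' => J (x, k'))).trans (Finset.card_le_univ _)
    rw [Fintype.card_fin] at h1
    have h2 : (((Finset.univ.filter (· < k)).image fun k' => J (x, k')).card : ℝ) ≤ δ := by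
      exact_mod_cast h1
    nlinarith [mul_nonneg (Nat.cast_nonneg (α := ℝ) d) (Nat.cast_nonneg (α := ℝ) δ)]
  · intro J hJ
    refine hJ.trans (Nat.mul_le_mul_left _ (Finset.card_le_card fun k hk => ?_))
    obtain ⟨k', hk', h⟩ := (Finset.mem_filter.1 hk).2
    exact Finset.mem_filter.2 ⟨Finset.mem_univ _, Finset.mem_image.2 ⟨k', by simpa, h⟩⟩

/-- Elements of Ω that avoid both `x` and `y` give a relation independent of the edges there, and
`rare_pairs` applies. Any other element colliding with `c` forces one of the two edges to meet a set
of at most `d + 1` vertices, by the row and column bounds on Ω. -/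
lemma rare_badPairs (hN : 0 < N) (hδ : N ≤ δ) (hm : 0 < m) (hρ : 0 < ρ) (hρ1 : ρ ≤ 1)
    {α β : Fin p → V} (hα : α.Injective) (hβ : β.Injective) {Ω : Finset (Fin p × Fin p)}
    (hΩ : IsDistributed d Ω) (h : ((d : ℝ) + 1) * δ ≤ (ρ / 2) ^ N * m)
    (h' : (p : ℝ) * d * δ ^ 2 ≤ ((ρ / 2) ^ N) ^ 2 / N * (m : ℝ) ^ 2) (c : Fin p × Fin p) :
    Rare (6 * ρ ^ δ) fun J : V × Fin δ → Fin m => 9 * δ ^ 2 < N * (badPairs α β Ω J c).card := by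
  classical
  obtain ⟨i, j⟩ := c
  set x := α i with hx
  set y := β j with hy
  have hδ0 : 0 < δ := hN.trans_le hδ
  set Ω' := Ω.filter fun c => (α c.1 ≠ x ∧ α c.1 ≠ y) ∧ β c.2 ≠ x ∧ β c.2 ≠ y with hΩ'
  let G : (V × Fin δ → Fin m) → Finset (Fin m × Fin m) := fun J =>
    (Ω' ×ˢ (Finset.univ : Finset (Fin δ × Fin δ))).image fun f =>
      (J (α f.1.1, f.2.1), J (β f.1.2, f.2.2))
  -- Removing `x` itself keeps the hit set independent of the edges at `x`; inserting `y` covers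
  -- elements with `α c.1 = y`. The set `Sy` is symmetric.
  let Sx : Finset V := insert y ((Ω.filter fun c => c.2 = j).image fun c => α c.1) \ {x}
  let Sy : Finset V := insert x ((Ω.filter fun c => c.1 = i).image fun c => β c.2) \ {y}
  have hGcard : ∀ J, ((G J).card : ℝ) ≤ ((ρ / 2) ^ N) ^ 2 / N * (m : ℝ) ^ 2 := by
    intro J
    refine le_trans ?_ h'
    have h1 : (G J).card ≤ (p * d) * δ ^ 2 := by
      refine Finset.card_image_le.trans ?_
      rw [Finset.card_product, Finset.card_univ, Fintype.card_prod, Fintype.card_fin, ← sq]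
      exact Nat.mul_le_mul_right _ ((Finset.card_filter_le _ _).trans hΩ.card_le)
    exact_mod_cast h1
  have hGinv : ∀ z, z = x ∨ z = y → ∀ J k v, G (Function.update J (z, k) v) = G J := by
    intro z hz J k v
    refine Finset.image_congr fun f hf => ?_
    have hf := (Finset.mem_filter.1 (Finset.mem_product.1 hf).1).2
    have h1 : α f.1.1 ≠ z := by rcases hz with rfl | rfl <;> tauto
    have h2 : β f.1.2 ≠ z := by rcases hz with rfl | rfl <;> tauto
    simp [Function.update_of_ne, h1, h2]
  have R1 := rare_pairs hN hm hδ0 hρ hρ1 x y G (hGinv x (.inl rfl)) (hGinv y (.inr rfl)) hGcard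
  -- For `x = y`, decreasing pairs of edges are the increasing pairs of the transposed relation.
  have R2 := rare_pairs hN hm hδ0 hρ hρ1 x y (fun J => (G J).image Prod.swap)
    (fun J k v => by rw [hGinv x (.inl rfl)]) (fun J k v => by rw [hGinv y (.inr rfl)])
    (fun J => le_trans (by exact_mod_cast Finset.card_image_le) (hGcard J))
  have R3 := rare_le_hits (S := Sx) (x := x) (N := N) hm hρ hρ1 (by simp [Sx])
    ((Finset.card_le_card Finset.sdiff_subset).trans ((Finset.card_insert_le _ _).trans
      (Nat.succ_le_succ (Finset.card_image_le.trans (hΩ.col_le j))))) h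
  have R4 := rare_le_hits (S := Sy) (x := y) (N := N) hm hρ hρ1 (by simp [Sy])
    ((Finset.card_le_card Finset.sdiff_subset).trans ((Finset.card_insert_le _ _).trans
      (Nat.succ_le_succ (Finset.card_image_le.trans (hΩ.row_le i))))) h
  refine (((R1.or R2).or (R3.or R4)).mono fun J hJ => ?_).weaken (by linarith)
  by_contra hcon
  push Not at hcon
  obtain ⟨⟨b1, b2⟩, b3, b4⟩ := hcon
  refine absurd hJ (not_lt.2 ?_)
  set P1 := Finset.univ.filter fun e : Fin δ × Fin δ =>
    (x ≠ y ∨ e.1 < e.2) ∧ (J (x, e.1), J (y, e.2)) ∈ G J with hP1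
  set P2 := Finset.univ.filter fun e : Fin δ × Fin δ =>
    (x ≠ y ∨ e.1 < e.2) ∧ (J (x, e.1), J (y, e.2)) ∈ (G J).image Prod.swap with hP2
  have hsub : badPairs α β Ω J (i, j) ⊆ hits Sx x J ×ˢ Finset.univ ∪ Finset.univ ×ˢ hits Sy y J ∪
      P1 ∪ P2.image Prod.swap ∪ Finset.univ.image fun k => (k, k) := by
    rintro ⟨k, l⟩ he
    obtain ⟨⟨i', j'⟩, hc', hne, ⟨k', hk'⟩, l', hl'⟩ := (Finset.mem_filter.1 he).2
    simp only [← hx, ← hy] at hk' hl'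
    have hSx : α i' ∈ Sx → k ∈ hits Sx x J := fun hmem =>
      Finset.mem_filter.2 ⟨Finset.mem_univ _, _, hmem, k', hk'⟩
    have hSy : β j' ∈ Sy → l ∈ hits Sy y J := fun hmem =>
      Finset.mem_filter.2 ⟨Finset.mem_univ _, _, hmem, l', hl'⟩
    simp only [Finset.mem_union, Finset.mem_product, Finset.mem_univ, and_true, true_and]
    by_cases c1 : α i' = x
    · have hi : i' = i := hα c1
      subst hi
      have hj : j' ≠ j := fun h => hne (by rw [h])
      refine .inl (.inl (.inl (.inr (hSy ?_))))
      simp only [Sy, Finset.mem_sdiff, Finset.mem_insert, Finset.mem_image, Finset.mem_filter,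
        Finset.mem_singleton]
      exact ⟨.inr ⟨_, ⟨hc', rfl⟩, rfl⟩, fun h => hj (hβ h)⟩
    by_cases c2 : β j' = y
    · have hj : j' = j := hβ c2
      subst hj
      refine .inl (.inl (.inl (.inl (hSx ?_))))
      simp only [Sx, Finset.mem_sdiff, Finset.mem_insert, Finset.mem_image, Finset.mem_filter,
        Finset.mem_singleton]
      exact ⟨.inr ⟨_, ⟨hc', rfl⟩, rfl⟩, c1⟩
    by_cases c3 : α i' = y
    · refine .inl (.inl (.inl (.inl (hSx ?_))))
      simp only [Sx, Finset.mem_sdiff, Finset.mem_insert, Finset.mem_singleton]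
      exact ⟨.inl c3, c1⟩
    by_cases c4 : β j' = x
    · refine .inl (.inl (.inl (.inr (hSy ?_))))
      simp only [Sy, Finset.mem_sdiff, Finset.mem_insert, Finset.mem_singleton]
      exact ⟨.inl c4, c2⟩
    have hG : (J (x, k), J (y, l)) ∈ G J := by
      refine Finset.mem_image.2 ⟨((i', j'), (k', l')), ?_, by rw [hk', hl']⟩
      simp only [hΩ', Finset.mem_product, Finset.mem_filter, Finset.mem_univ, and_true]
      exact ⟨hc', ⟨c1, c3⟩, c4, c2⟩
    by_cases hkl : x ≠ y ∨ k < l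
    · exact .inl (.inl (.inr (Finset.mem_filter.2 ⟨Finset.mem_univ _, hkl, hG⟩)))
    · push Not at hkl
      rcases hkl.2.eq_or_lt with h1 | h1
      · exact .inr (Finset.mem_image.2 ⟨k, Finset.mem_univ _, by rw [h1]⟩)
      · refine .inl (.inr (Finset.mem_image.2 ⟨(l, k), ?_, rfl⟩))
        refine Finset.mem_filter.2 ⟨Finset.mem_univ _, .inr h1, Finset.mem_image.2 ⟨_, hG, ?_⟩⟩
        simp [hkl.1]
  have hc1 := Finset.card_le_card hsub
  have hc2 := Finset.card_union_le (hits Sx x J ×ˢ Finset.univ ∪ Finset.univ ×ˢ hits Sy y J ∪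
      P1 ∪ P2.image Prod.swap) (Finset.univ.image fun k => (k, k))
  have hc3 := Finset.card_union_le (hits Sx x J ×ˢ Finset.univ ∪ Finset.univ ×ˢ hits Sy y J ∪
      P1) (P2.image Prod.swap)
  have hc4 := Finset.card_union_le
    (hits Sx x J ×ˢ Finset.univ ∪ Finset.univ ×ˢ hits Sy y J) P1
  have hc5 := Finset.card_union_le (hits Sx x J ×ˢ (Finset.univ : Finset (Fin δ)))
    (Finset.univ ×ˢ hits Sy y J)
  have hc6 : (P2.image Prod.swap).card ≤ P2.card := Finset.card_image_le
  have hc7 : ((Finset.univ : Finset (Fin δ)).image fun k => (k, k)).card ≤ δ := by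
    simpa using Finset.card_image_le (s := (Finset.univ : Finset (Fin δ))) (f := fun k => (k, k))
  simp only [Finset.card_product, Finset.card_univ, Fintype.card_fin] at hc5
  have hc : (badPairs α β Ω J (i, j)).card ≤
      (hits Sx x J).card * δ + δ * (hits Sy y J).card + P1.card + P2.card + δ := by omega
  -- The 9 is 1 + 1 from the hits, 3 + 3 from `P1` and `P2`, and 1 from the diagonal, where `N * δ ≤
  -- δ ^ 2`.
  nlinarith [Nat.mul_le_mul_left N hc, Nat.mul_le_mul_right δ b3.le, Nat.mul_le_mul_right δ b4.le,
    Nat.mul_le_mul_right δ hδ]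

lemma rare_collisions (hN : 0 < N) (hδ : N ≤ δ) (hm : 0 < m) (hρ : 0 < ρ) (hρ1 : ρ ≤ 1)
    {α β : Fin p → V} (hα : α.Injective) (hβ : β.Injective) {Ω : Finset (Fin p × Fin p)}
    (hΩ : IsDistributed d Ω) (h : ((d : ℝ) + 1) * δ ≤ (ρ / 2) ^ N * m)
    (h' : (p : ℝ) * d * δ ^ 2 ≤ ((ρ / 2) ^ N) ^ 2 / N * (m : ℝ) ^ 2) :
    Rare (8 * (p : ℝ) ^ 2 * ρ ^ δ) fun J : V × Fin δ → Fin m =>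
      (∃ c, 9 * δ ^ 2 < N * (badPairs α β Ω J c).card) ∨
        (∃ i, δ ≤ N * (repeats (α i) J).card) ∨ ∃ j, δ ≤ N * (repeats (β j) J).card := by
  have R1 := rare_exists fun c => rare_badPairs hN hδ hm hρ hρ1 hα hβ hΩ h h' c
  have R2 := rare_exists fun i => rare_le_repeats hm hρ hρ1 (α i) h
  have R3 := rare_exists fun j => rare_le_repeats hm hρ hρ1 (β j) h
  refine (R1.or (R2.or R3)).weaken ?_
  simp only [Fintype.card_prod, Fintype.card_fin, Nat.cast_mul]
  have hp : (p : ℝ) ≤ p ^ 2 := by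
    exact_mod_cast Nat.le_self_pow two_ne_zero p
  have : 0 < ρ ^ δ := by positivity
  nlinarith [mul_le_mul_of_nonneg_right hp this.le]

end Collisions

/-! ### Null space property from nearly disjoint columns -/

section NullSpace

open Classical in
/-- If the columns of a nonnegative matrix indexed by `S` have mass at least `s * D` and every
column has mass at most `t * D` on the rows met by other columns of `S`, then vectors in the kernel
are not concentrated on `S`. -/
lemma sum_abs_le_of_kernel {R L : Type*} [Fintype R] [Fintype L] [DecidableEq L] {M : R → L → ℝ}
    (hM : ∀ r c, 0 ≤ M r c) {S : Finset L} {D s t : ℝ} (hD : 0 < D)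
    (hmass : ∀ c ∈ S, s * D ≤ ∑ r, M r c)
    (hbad : ∀ c, ∑ r with ∃ c' ∈ S, c' ≠ c ∧ M r c' ≠ 0, M r c ≤ t * D)
    {z : L → ℝ} (hz : ∀ r, ∑ c, M r c * z c = 0) :
    (s - t) * ∑ c ∈ S, |z c| ≤ t * ∑ c ∈ Sᶜ, |z c| := by
  let U : L → R → Prop := fun c r => ∃ c' ∈ S, c' ≠ c ∧ M r c' ≠ 0
  have hnn : ∀ r c, 0 ≤ M r c * |z c| := fun r c => mul_nonneg (hM r c) (abs_nonneg _)
  have hrow : ∀ r, ∑ c ∈ S, (if U c r then 0 else M r c * |z c|) ≤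
      ∑ c ∈ Sᶜ, if U c r then M r c * |z c| else 0 := by
    intro r
    have hR : 0 ≤ ∑ c ∈ Sᶜ, if U c r then M r c * |z c| else 0 :=
      Finset.sum_nonneg fun c _ => by split_ifs; exacts [hnn r c, le_rfl]
    -- In this case `c` is the only column of `S` meeting row `r`, so the kernel equation bounds its
    -- term by the columns outside `S`, all of which see `r` as bad. Otherwise the left side
    -- vanishes.
    by_cases h : ∃ c ∈ S, M r c ≠ 0 ∧ ¬ U c r
    · obtain ⟨c₀, hc₀, h0, hU⟩ := h
      have hzero : ∀ c ∈ S, c ≠ c₀ → M r c = 0 := fun c hc hne => by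
        by_contra h1
        exact hU ⟨c, hc, hne, h1⟩
      have hsum : M r c₀ * z c₀ + ∑ c ∈ Sᶜ, M r c * z c = 0 := by
        rw [← hz r, ← Finset.sum_add_sum_compl S]
        congr 1
        exact (Finset.sum_eq_single_of_mem (f := fun c => M r c * z c) c₀ hc₀
          fun c hc hne => by simp [hzero c hc hne]).symm
      calc _ = M r c₀ * |z c₀| := by
            rw [Finset.sum_eq_single_of_mem c₀ hc₀ fun c hc hne => by simp [hzero c hc hne],
              if_neg hU]
        _ = |∑ c ∈ Sᶜ, M r c * z c| := by
            rw [← abs_of_nonneg (hM r c₀), ← abs_mul, eq_neg_of_add_eq_zero_left hsum, abs_neg]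
        _ ≤ ∑ c ∈ Sᶜ, |M r c * z c| := Finset.abs_sum_le_sum_abs _ _
        _ = _ := by
            refine Finset.sum_congr rfl fun c hc => ?_
            rw [if_pos ⟨c₀, hc₀, fun h => Finset.mem_compl.1 hc (h ▸ hc₀), h0⟩, abs_mul,
              abs_of_nonneg (hM r c)]
    · push Not at h
      refine (Finset.sum_nonpos fun c hc => ?_).trans hR
      split_ifs with hU
      · exact le_rfl
      · have : M r c = 0 := by
          by_contra h0
          exact hU (h c hc h0)
        simp [this]
  have hS : ∀ c ∈ S, (s - t) * D * |z c| ≤ ∑ r, if U c r then 0 else M r c * |z c| := by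
    intro c hc
    have h1 := Finset.sum_filter_add_sum_filter_not Finset.univ (fun r => U c r) fun r => M r c
    have h2 : ∑ r, (if U c r then 0 else M r c * |z c|) = (∑ r with ¬ U c r, M r c) * |z c| := by
      rw [Finset.sum_mul, Finset.sum_filter]
      exact Finset.sum_congr rfl fun r _ => by split_ifs <;> simp_all
    rw [h2]
    refine mul_le_mul_of_nonneg_right ?_ (abs_nonneg _)
    have h3 := hbad c
    have h4 := hmass c hc
    simp only [U] at h1 ⊢
    linarith
  have hSc : ∀ c ∈ Sᶜ, ∑ r, (if U c r then M r c * |z c| else 0) ≤ t * D * |z c| := by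
    intro c _
    rw [← Finset.sum_filter, ← Finset.sum_mul]
    exact mul_le_mul_of_nonneg_right (hbad c) (abs_nonneg _)
  have key : ∑ c ∈ S, (s - t) * D * |z c| ≤ ∑ c ∈ Sᶜ, t * D * |z c| :=
    calc _ ≤ ∑ c ∈ S, ∑ r, (if U c r then 0 else M r c * |z c|) := Finset.sum_le_sum hS
      _ = ∑ r, ∑ c ∈ S, (if U c r then 0 else M r c * |z c|) := Finset.sum_comm
      _ ≤ ∑ r, ∑ c ∈ Sᶜ, (if U c r then M r c * |z c| else 0) :=
        Finset.sum_le_sum fun r _ => hrow r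
      _ = ∑ c ∈ Sᶜ, ∑ r, (if U c r then M r c * |z c| else 0) := Finset.sum_comm
      _ ≤ _ := Finset.sum_le_sum hSc
  rw [← Finset.mul_sum, ← Finset.mul_sum] at key
  refine le_of_mul_le_mul_right ?_ hD
  linarith

end NullSpace

/-! ### Existence and stability of minimizers -/

section Program

variable {p m : ℕ}

/-- Competitors of norm above that of `W₀` are irrelevant, and the remaining feasible ones lie in a
compact box. -/
lemma exists_isL1Solution (A B : Matrix (Fin m) (Fin p) ℝ) (W₀ : Matrix (Fin p) (Fin p) ℝ) :
    ∃ Z, IsL1Solution A B (A * W₀ * B.transpose) Z := by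
  have hcont : Continuous (l1Norm : Matrix (Fin p) (Fin p) ℝ → ℝ) := by
    unfold l1Norm
    fun_prop
  have hbox : IsCompact {W : Matrix (Fin p) (Fin p) ℝ | ∀ i j, W i j ∈
      Set.Icc (-l1Norm W₀) (l1Norm W₀)} := by
    have := isCompact_pi_infinite (X := fun _ : Fin p => Fin p → ℝ) fun _ : Fin p =>
      isCompact_pi_infinite (X := fun _ : Fin p => ℝ) fun _ : Fin p =>
        isCompact_Icc (a := -l1Norm W₀) (b := l1Norm W₀)
    exact this
  have hentry : ∀ (W : Matrix (Fin p) (Fin p) ℝ) i j, |W i j| ≤ l1Norm W := fun W i j =>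
    (Finset.single_le_sum (f := fun j => |W i j|) (fun _ _ => abs_nonneg _)
      (Finset.mem_univ j)).trans
      (Finset.single_le_sum (f := fun i => ∑ j, |W i j|)
        (fun _ _ => Finset.sum_nonneg fun _ _ => abs_nonneg _) (Finset.mem_univ i))
  have hclosed : IsClosed {W : Matrix (Fin p) (Fin p) ℝ |
      A * W * B.transpose = A * W₀ * B.transpose} :=
    isClosed_eq (by fun_prop) continuous_const
  obtain ⟨Z, ⟨_, hZ⟩, hmin⟩ := (hbox.inter_right hclosed).exists_isMinOn
    ⟨W₀, fun i j => abs_le.1 (hentry W₀ i j), rfl⟩ hcont.continuousOn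
  refine ⟨Z, hZ, fun W hW => ?_⟩
  by_cases h : l1Norm W ≤ l1Norm W₀
  · exact hmin ⟨fun i j => abs_le.1 ((hentry W i j).trans h), hW⟩
  · exact (hmin ⟨fun i j => abs_le.1 (hentry W₀ i j), rfl⟩).trans (le_of_not_ge h)

lemma l1Norm_eq_sum (Z : Matrix (Fin p) (Fin p) ℝ) :
    l1Norm Z = ∑ c : Fin p × Fin p, |Z c.1 c.2| := by
  rw [l1Norm, Fintype.sum_prod_type]

/-- The null space property with constant `1 / 2` yields stable recovery with factor `7`. -/
lemma noisyRecovery_of_nullSpace {A B : Matrix (Fin m) (Fin p) ℝ} {X : Matrix (Fin p) (Fin p) ℝ}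
    {Ω : Finset (Fin p × Fin p)} (hX : ∀ i j, X i j ≠ 0 → (i, j) ∈ Ω)
    (hnull : ∀ Z : Matrix (Fin p) (Fin p) ℝ, A * Z * B.transpose = 0 →
      2 * ∑ c ∈ Ω, |Z c.1 c.2| ≤ ∑ c ∈ Ωᶜ, |Z c.1 c.2|) :
    NoisyRecovery (1 / 8) A B X := by
  intro N
  refine ⟨exists_isL1Solution A B (X + N), fun Z ⟨hZ, hmin⟩ => ?_⟩
  -- With `η = Z - (X + N)`, minimality gives `‖η‖ off Ω ≤ ‖η‖ on Ω + 2 ‖N‖ off Ω`. The null space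
  -- property then yields `‖η‖ ≤ 6 ‖N‖`, and `Z - X = η + N` makes it 7.
  have h0 := hnull (Z - (X + N)) (by rw [Matrix.mul_sub, Matrix.sub_mul, hZ, sub_self])
  have h1 := hmin (X + N) rfl
  simp only [l1Norm_eq_sum, ← Finset.sum_add_sum_compl Ω] at h1 ⊢
  have hXc : ∀ c ∈ Ωᶜ, X c.1 c.2 = 0 := fun c hc => by
    by_contra h
    exact Finset.mem_compl.1 hc (hX _ _ h)
  have e1 : ∑ c ∈ Ω, |Z c.1 c.2| ≥ ∑ c ∈ Ω, |(X + N) c.1 c.2| -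
      ∑ c ∈ Ω, |(Z - (X + N)) c.1 c.2| := by
    rw [← Finset.sum_sub_distrib]
    refine Finset.sum_le_sum fun c _ => ?_
    have := abs_sub_abs_le_abs_sub ((X + N) c.1 c.2) (Z c.1 c.2)
    rw [abs_sub_comm] at this
    simp only [Matrix.sub_apply]
    linarith
  have e2 : ∑ c ∈ Ωᶜ, |Z c.1 c.2| ≥ ∑ c ∈ Ωᶜ, |(Z - (X + N)) c.1 c.2| -
      ∑ c ∈ Ωᶜ, |N c.1 c.2| := by
    rw [← Finset.sum_sub_distrib]
    refine Finset.sum_le_sum fun c hc => ?_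
    have := abs_sub (Z c.1 c.2) (N c.1 c.2)
    simp only [Matrix.sub_apply, Matrix.add_apply, hXc c hc, zero_add]
    linarith
  have e3 : ∑ c ∈ Ωᶜ, |(X + N) c.1 c.2| = ∑ c ∈ Ωᶜ, |N c.1 c.2| :=
    Finset.sum_congr rfl fun c hc => by simp [hXc c hc]
  have e4 : ∀ s : Finset (Fin p × Fin p), ∑ c ∈ s, |(Z - X) c.1 c.2| ≤
      ∑ c ∈ s, |(Z - (X + N)) c.1 c.2| + ∑ c ∈ s, |N c.1 c.2| := by
    intro s
    rw [← Finset.sum_add_distrib]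
    refine Finset.sum_le_sum fun c _ => ?_
    refine le_trans (le_of_eq ?_) (abs_add_le _ _)
    congr 1
    simp only [Matrix.sub_apply, Matrix.add_apply]
    ring
  have e5 := e4 Ω
  have e6 := e4 Ωᶜ
  have e7 : 0 ≤ ∑ c ∈ Ω, |N c.1 c.2| := Finset.sum_nonneg fun _ _ => abs_nonneg _
  rw [show (5 - 12 * (1 / 8 : ℝ)) / (1 - 4 * (1 / 8)) = 7 by norm_num]
  linarith

end Program

/-! ### Both adjacency conventions -/

section Adjacency

variable {p m δ : ℕ}

/-- A nonnegative matrix dominated by the edge counts whose columns lose at most the fraction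
`1 / 40` of the total count. -/
structure IsNearCount (J : EdgeChoice p m δ) (A : Matrix (Fin m) (Fin p) ℝ) : Prop where
  nonneg : ∀ u i, 0 ≤ A u i
  le_count : ∀ u i, A u i ≤ countMatrix J u i
  mass : ∀ i, 39 / 40 * (δ : ℝ) ≤ ∑ u, A u i

lemma IsNearCount.exists_edge {J : EdgeChoice p m δ} {A : Matrix (Fin m) (Fin p) ℝ}
    (h : IsNearCount J A) {u : Fin m} {i : Fin p} (hu : A u i ≠ 0) : ∃ k, J (i, k) = u := by
  by_contra hc
  push Not at hc
  refine hu (le_antisymm ((h.le_count u i).trans (le_of_eq ?_)) (h.nonneg u i))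
  simp [countMatrix, hc]

lemma isNearCount_countMatrix (J : EdgeChoice p m δ) : IsNearCount J (countMatrix J) where
  nonneg u i := Nat.cast_nonneg _
  le_count u i := le_rfl
  mass i := by
    have : ∑ u, countMatrix J u i = δ := by
      simp only [countMatrix]
      rw [← Nat.cast_sum, ← Finset.card_eq_sum_card_fiberwise fun _ _ => Finset.mem_univ _]
      simp
    rw [this]
    linarith [Nat.cast_nonneg (α := ℝ) δ]

/-- Edges that repeat no earlier one have distinct end points, so merging loses at most the number
of repeats. -/
lemma isNearCount_zeroOneMatrix {J : EdgeChoice p m δ}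
    (h : ∀ i, 40 * (repeats i J).card ≤ δ) : IsNearCount J (zeroOneMatrix J) where
  nonneg u i := by
    unfold zeroOneMatrix
    split_ifs <;> norm_num
  le_count u i := by
    unfold zeroOneMatrix countMatrix
    split_ifs with hk
    · obtain ⟨k, hk⟩ := hk
      exact_mod_cast Finset.card_pos.2 ⟨k, by simpa using hk⟩
    · exact Nat.cast_nonneg _
  mass i := by
    classical
    have h1 : (repeats i J)ᶜ.card ≤ (Finset.univ.filter fun u => ∃ k, J (i, k) = u).card := by
      refine Finset.card_le_card_of_injOn (fun k => J (i, k)) (fun k _ => by simp) ?_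
      intro k hk k' hk' hkk'
      simp only [repeats, Finset.coe_compl, Set.mem_compl_iff, Finset.mem_coe, Finset.mem_filter,
        Finset.mem_univ, true_and, not_exists, not_and] at hk hk'
      rcases lt_trichotomy k k' with hlt | heq | hlt
      · exact absurd hkk' (hk' k hlt)
      · exact heq
      · exact absurd hkk'.symm (hk k' hlt)
    rw [Finset.card_compl, Fintype.card_fin] at h1
    have h2 : 39 * δ ≤ 40 * (Finset.univ.filter fun u => ∃ k, J (i, k) = u).card := by
      have := h i
      omega
    have h3 : ∑ u, zeroOneMatrix J u i = (Finset.univ.filter fun u => ∃ k, J (i, k) = u).card := by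
      simp only [zeroOneMatrix, Finset.sum_boole]
    rw [h3]
    have : (39 : ℝ) * δ ≤ 40 * (Finset.univ.filter fun u => ∃ k, J (i, k) = u).card := by
      exact_mod_cast h2
    linarith

/-- Grouping edge pairs by their end points turns the mass on bad rows into the cardinality of
`badPairs`. -/
lemma sum_countMatrix_mul (J J' : EdgeChoice p m δ) (i j : Fin p) (P : Fin m × Fin m → Prop)
    [DecidablePred P] :
    ∑ r with P r, countMatrix J r.1 i * countMatrix J' r.2 j =
      (Finset.univ.filter fun e : Fin δ × Fin δ => P (J (i, e.1), J' (j, e.2))).card := by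
  rw [Finset.card_eq_sum_card_fiberwise (f := fun e => (J (i, e.1), J' (j, e.2)))
    (t := Finset.univ.filter P) (fun e he => by simpa using he)]
  push_cast
  refine Finset.sum_congr rfl fun r hr => ?_
  simp only [countMatrix]
  rw [← Nat.cast_mul, ← Finset.card_product]
  congr 2
  ext e
  simp only [Finset.mem_filter, Finset.mem_univ, true_and, Finset.mem_product] at hr ⊢
  constructor
  · rintro ⟨h1, h2⟩
    rw [h1, h2]
    exact ⟨hr, rfl⟩
  · rintro ⟨_, h⟩
    exact Prod.ext_iff.1 h

lemma noisyRecovery_of_collisions {V : Type*} (hδ : 0 < δ) {J : V × Fin δ → Fin m}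
    {α β : Fin p → V} {Ω : Finset (Fin p × Fin p)}
    (hbad : ∀ c, 40 * (badPairs α β Ω J c).card ≤ 9 * δ ^ 2)
    {A B : Matrix (Fin m) (Fin p) ℝ} (hA : IsNearCount (fun e => J (α e.1, e.2)) A)
    (hB : IsNearCount (fun e => J (β e.1, e.2)) B)
    {X : Matrix (Fin p) (Fin p) ℝ} (hX : ∀ i j, X i j ≠ 0 → (i, j) ∈ Ω) :
    NoisyRecovery (1 / 8) A B X := by
  classical
  refine noisyRecovery_of_nullSpace hX fun Z hZ => ?_
  have hδ' : (0 : ℝ) < δ := by exact_mod_cast hδ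
  -- Numerically `s - t = (39 / 40) ^ 2 - 9 / 40 ≥ 2 * t`, which is the required factor 2.
  have key := sum_abs_le_of_kernel (R := Fin m × Fin m) (L := Fin p × Fin p)
    (M := fun r c => A r.1 c.1 * B r.2 c.2) (S := Ω) (D := (δ : ℝ) ^ 2) (s := (39 / 40) ^ 2)
    (t := 9 / 40) (z := fun c => Z c.1 c.2)
    (fun r c => mul_nonneg (hA.nonneg _ _) (hB.nonneg _ _)) (by positivity) ?_ ?_ ?_
  · have : 0 ≤ ∑ c ∈ Ω, |Z c.1 c.2| := Finset.sum_nonneg fun _ _ => abs_nonneg _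
    norm_num at key
    linarith
  · intro c _
    have h : ∑ r : Fin m × Fin m, A r.1 c.1 * B r.2 c.2 = (∑ u, A u c.1) * ∑ v, B v c.2 := by
      rw [Fintype.sum_prod_type, Finset.sum_mul_sum]
    rw [h, ← mul_pow, sq]
    exact mul_le_mul (hA.mass _) (hB.mass _) (by positivity)
      (Finset.sum_nonneg fun u _ => hA.nonneg u _)
  · intro c
    refine (Finset.sum_le_sum fun r _ => mul_le_mul (hA.le_count _ _) (hB.le_count _ _)
      (hB.nonneg _ _) ((hA.nonneg _ _).trans (hA.le_count _ _))).trans ?_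
    refine le_of_eq_of_le (sum_countMatrix_mul _ _ _ _ _) ?_
    have h : (40 : ℝ) * (badPairs α β Ω J c).card ≤ 9 * (δ : ℝ) ^ 2 := by exact_mod_cast hbad c
    refine le_trans (Nat.cast_le.2 (Finset.card_le_card (t := badPairs α β Ω J c)
      fun e he => ?_)) (by linarith)
    obtain ⟨c', hc', hne, h0⟩ := (Finset.mem_filter.1 he).2
    exact Finset.mem_filter.2 ⟨Finset.mem_univ _, c', hc', hne,
      hA.exists_edge (left_ne_zero_of_mul h0), hB.exists_edge (right_ne_zero_of_mul h0)⟩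
  · rintro ⟨u, v⟩
    have h := congrFun (congrFun hZ u) v
    simp only [Matrix.mul_apply, Matrix.transpose_apply, Matrix.zero_apply] at h
    rw [← h, Fintype.sum_prod_type_right]
    refine Finset.sum_congr rfl fun j _ => ?_
    rw [Finset.sum_mul]
    exact Finset.sum_congr rfl fun i _ => by ring

end Adjacency

/-! ### Uniform law and numerical bounds -/

section Law

variable {p m δ d : ℕ}

lemma isProbabilityMeasure_edgeLaw (hm : 0 < m) : IsProbabilityMeasure (edgeLaw p m δ) := by
  have : NeZero m := ⟨hm.ne'⟩
  have : IsProbabilityMeasure (uniformOn (Set.univ : Set (Fin m))) :=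
    isProbabilityMeasure_uniformOn Set.finite_univ Set.univ_nonempty
  unfold edgeLaw
  infer_instance

lemma edgeLaw_real_singleton (hm : 0 < m) (J : EdgeChoice p m δ) :
    (edgeLaw p m δ).real {J} = (Nat.card (EdgeChoice p m δ) : ℝ)⁻¹ := by
  have : NeZero m := ⟨hm.ne'⟩
  have : IsProbabilityMeasure (uniformOn (Set.univ : Set (Fin m))) :=
    isProbabilityMeasure_uniformOn Set.finite_univ Set.univ_nonempty
  rw [edgeLaw, measureReal_def, Measure.pi_singleton, ENNReal.toReal_prod]
  have : ∀ u : Fin m, (uniformOn (Set.univ : Set (Fin m)) {u}).toReal = (m : ℝ)⁻¹ := by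
    intro u
    rw [uniformOn_univ]
    simp
  simp [this]

/-- Bounded failure counts bound the failure probability under a uniform law. -/
lemma Rare.le_real {α : Type*} [Finite α] [MeasurableSpace α] [MeasurableSingletonClass α]
    {μ : Measure α} [IsProbabilityMeasure μ] (hμ : ∀ x, μ.real {x} = (Nat.card α : ℝ)⁻¹)
    {τ : ℝ} {P : α → Prop} (h : Rare τ fun x => ¬ P x) : 1 - τ ≤ μ.real {x | P x} := by
  classical
  have := Fintype.ofFinite α
  have hcompl : {x | P x} = {x | ¬ P x}ᶜ := by
    ext x
    simp
  have hne : Nonempty α := by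
    by_contra hc
    rw [not_nonempty_iff] at hc
    have := measure_univ (μ := μ)
    simp [Set.univ_eq_empty_iff.2 hc] at this
  have hpos : (0 : ℝ) < Nat.card α := by exact_mod_cast Nat.card_pos
  have hreal : μ.real {x | ¬ P x} = ({x | ¬ P x}.ncard : ℝ) * (Nat.card α : ℝ)⁻¹ := by
    have := sum_measureReal_singleton (μ := μ) (Finset.univ.filter fun x => ¬ P x)
    simp only [hμ, Finset.sum_const, nsmul_eq_mul, Finset.coe_filter, Finset.mem_univ,
      true_and] at this
    rw [← this, Set.ncard_eq_toFinset_card', Set.toFinset_ofPred]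
  rw [hcompl, probReal_compl_eq_one_sub (Set.toFinite _).measurableSet, hreal]
  have : ({x | ¬ P x}.ncard : ℝ) * (Nat.card α : ℝ)⁻¹ ≤ τ := by
    rw [← div_eq_mul_inv, div_le_iff₀ hpos]
    exact h
  linarith

/-- A pair of edge choices is an edge choice on the disjoint union of the left vertex sets. -/
def sumEdgeChoiceEquiv (p m δ : ℕ) :
    ((Fin p ⊕ Fin p) × Fin δ → Fin m) ≃ EdgeChoice p m δ × EdgeChoice p m δ where
  toFun J := (fun e => J (Sum.inl e.1, e.2), fun e => J (Sum.inr e.1, e.2))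
  invFun q e := Sum.elim (fun i => q.1 (i, e.2)) (fun i => q.2 (i, e.2)) e.1
  left_inv J := by
    funext ⟨x, k⟩
    cases x <;> rfl
  right_inv q := rfl

lemma Rare.of_equiv {α β : Type*} (e : α ≃ β) {τ : ℝ} {P : β → Prop}
    (h : Rare τ fun x => P (e x)) : Rare τ P := by
  unfold Rare at h ⊢
  rwa [← Nat.card_congr e, ← Set.ncard_preimage_of_injective_subset_range e.injective
    (by simp [e.surjective.range_eq])]

lemma rare_not_noisyRecovery {V : Type*} [Fintype V] [DecidableEq V] {ρ : ℝ} (hδ : 40 ≤ δ)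
    (hm : 0 < m) (hρ : 0 < ρ) (hρ1 : ρ ≤ 1) {α β : Fin p → V} (hα : α.Injective)
    (hβ : β.Injective) {adj : EdgeChoice p m δ → Matrix (Fin m) (Fin p) ℝ}
    (hadj : adj = countMatrix ∨ adj = zeroOneMatrix) {X : Matrix (Fin p) (Fin p) ℝ}
    (hX : IsDistributedSparse d X) (h : ((d : ℝ) + 1) * δ ≤ (ρ / 2) ^ 40 * m)
    (h' : (p : ℝ) * d * δ ^ 2 ≤ ((ρ / 2) ^ 40) ^ 2 / 40 * (m : ℝ) ^ 2) :
    Rare (8 * (p : ℝ) ^ 2 * ρ ^ δ) fun J : V × Fin δ → Fin m =>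
      ¬ NoisyRecovery (1 / 8) (adj fun e => J (α e.1, e.2)) (adj fun e => J (β e.1, e.2)) X := by
  obtain ⟨Ω, hΩ, hXΩ⟩ := hX
  refine (rare_collisions (N := 40) (by norm_num) hδ hm hρ hρ1 hα hβ hΩ h
    (by exact_mod_cast h')).mono fun J hJ => ?_
  by_contra hcon
  push Not at hcon
  obtain ⟨h1, h2, h3⟩ := hcon
  have hnear : ∀ γ : Fin p → V, (∀ i, 40 * (repeats (γ i) J).card < δ) →
      IsNearCount (fun e => J (γ e.1, e.2)) (adj fun e => J (γ e.1, e.2)) := by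
    intro γ hγ
    rcases hadj with rfl | rfl
    · exact isNearCount_countMatrix _
    · exact isNearCount_zeroOneMatrix fun i => (hγ i).le
  exact hJ (noisyRecovery_of_collisions (by omega) h1 (hnear α h2) (hnear β h3) hXΩ)

/-- The sparsity `d` may exceed `p`. Truncated to `e = min d p` it satisfies `e ≤ √(e p)`, so the
lower bound on `m` also controls `(e + 1) * δ`. -/
lemma IsDistributedSparse.min {X : Matrix (Fin p) (Fin p) ℝ} (h : IsDistributedSparse d X) :
    IsDistributedSparse (min d p) X := by
  obtain ⟨S, hS, hX⟩ := h
  refine ⟨S, ⟨fun i => le_min (hS.row_le i) ?_, fun j => le_min (hS.col_le j) ?_⟩, hX⟩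
  · calc _ ≤ (Finset.univ : Finset (Fin p)).card := Finset.card_le_card_of_injOn Prod.snd
          (by simp) fun x hx y hy hxy => Prod.ext
            ((Finset.mem_filter.1 hx).2.trans (Finset.mem_filter.1 hy).2.symm) hxy
      _ = p := by simp
  · calc _ ≤ (Finset.univ : Finset (Fin p)).card := Finset.card_le_card_of_injOn Prod.fst
          (by simp) fun x hx y hy hxy => Prod.ext hxy
            ((Finset.mem_filter.1 hx).2.trans (Finset.mem_filter.1 hy).2.symm)
      _ = p := by simp

/-- The size conditions on `δ` and `m` make the density of collisions as small as required. -/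
lemma density_bounds {b q : ℝ} (hb : 0 < b) (hq : 0 < q) (hp : 1 < p) (hd : 1 ≤ d)
    (hδ : (δ : ℝ) ≤ b * Real.log p)
    (hm : 7 * b / q * Real.sqrt ((d : ℝ) * (p : ℝ)) * Real.log p ≤ (m : ℝ)) :
    0 < m ∧ (((min d p : ℕ) : ℝ) + 1) * δ ≤ q * m ∧
      (p : ℝ) * (min d p : ℕ) * δ ^ 2 ≤ q ^ 2 / 40 * (m : ℝ) ^ 2 := by
  set e := min d p with he
  have hlog : 0 < Real.log p := Real.log_pos (by exact_mod_cast hp)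
  have he1 : (1 : ℝ) ≤ e := by exact_mod_cast (le_min hd hp.le : 1 ≤ e)
  have hep : (e : ℝ) ≤ p := by exact_mod_cast min_le_right d p
  have hed : (e : ℝ) ≤ d := by exact_mod_cast min_le_left d p
  set r := Real.sqrt ((e : ℝ) * p) with hr
  have hr2 : r ^ 2 = e * p := Real.sq_sqrt (by positivity)
  have her : (e : ℝ) ≤ r := Real.le_sqrt_of_sq_le (by nlinarith)
  have hrd : r ≤ Real.sqrt ((d : ℝ) * p) :=
    Real.sqrt_le_sqrt (mul_le_mul_of_nonneg_right hed (Nat.cast_nonneg _))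
  have hqm : 7 * b * r * Real.log p ≤ q * m := by
    have h1 : 7 * b / q * r * Real.log p ≤ m := by
      refine le_trans ?_ hm
      gcongr
    calc 7 * b * r * Real.log p = q * (7 * b / q * r * Real.log p) := by field_simp
      _ ≤ q * m := mul_le_mul_of_nonneg_left h1 hq.le
  have hrδ : r * δ ≤ b * r * Real.log p := by
    calc r * δ ≤ r * (b * Real.log p) := mul_le_mul_of_nonneg_left hδ (by linarith)
      _ = _ := by ring
  have hpos : 0 < b * r * Real.log p := by
    have : 0 < r := by linarith
    positivity
  have hrδm : 7 * (r * δ) ≤ q * m := by linarith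
  refine ⟨?_, ?_, ?_⟩
  · have : 0 < q * m := by linarith
    exact_mod_cast pos_of_mul_pos_right this hq.le
  · have : ((e : ℝ) + 1) * δ ≤ 2 * r * δ :=
      mul_le_mul_of_nonneg_right (by linarith) (Nat.cast_nonneg _)
    have : 0 ≤ r * δ := by positivity
    linarith
  · have h1 : (7 * (r * δ)) ^ 2 ≤ (q * m) ^ 2 := pow_le_pow_left₀ (by positivity) hrδm 2
    have h2 : (p : ℝ) * e * δ ^ 2 = (r * δ) ^ 2 := by rw [mul_pow, hr2]; ring
    rw [h2]
    -- Here the constant 7 matters: 7² ≥ 40.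
    nlinarith [sq_nonneg (r * δ)]

/-- From δ ≥ a log p the exponential is at most p⁻⁴; two powers pay for the union bound, and `8 / p
< 1` leaves p⁻¹. -/
lemma failure_lt {a : ℝ} (ha : 0 < a) (hp : 9 ≤ p) (hδ : a * Real.log p ≤ (δ : ℝ)) :
    8 * (p : ℝ) ^ 2 * Real.exp (-4 / a) ^ δ < (p : ℝ) ^ (-1 : ℝ) := by
  have hp' : (9 : ℝ) ≤ p := by exact_mod_cast hp
  have hp0 : (0 : ℝ) < p := by linarith
  have h1 : Real.exp (-4 / a) ^ δ ≤ ((p : ℝ) ^ 4)⁻¹ := by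
    rw [← Real.exp_nat_mul, ← Real.exp_log (by positivity : (0 : ℝ) < ((p : ℝ) ^ 4)⁻¹),
      Real.log_inv, Real.log_pow]
    refine Real.exp_le_exp.2 ?_
    have : (δ : ℝ) * (-4 / a) = -(4 * (δ / a)) := by ring
    rw [this]
    have : Real.log p ≤ δ / a := by rwa [le_div_iff₀ ha, mul_comm]
    push_cast
    linarith
  rw [Real.rpow_neg_one]
  calc 8 * (p : ℝ) ^ 2 * Real.exp (-4 / a) ^ δ ≤ 8 * (p : ℝ) ^ 2 * ((p : ℝ) ^ 4)⁻¹ := by gcongr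
    _ = 8 / p * (p : ℝ)⁻¹ := by field_simp
    _ < 1 * (p : ℝ)⁻¹ := by
        refine mul_lt_mul_of_pos_right ?_ (by positivity)
        rw [div_lt_one hp0]
        linarith
    _ = _ := one_mul _

end Law

end Sketching

/-! ### Choice of constants and the two cases -/

theorem mainTheorem6 :
    ∃ ε : ℝ, 0 < ε ∧ ε < 1 / 4 ∧
      ∀ a b : ℝ, 0 < a → a ≤ b →
        ∃ C c : ℝ, 0 < C ∧ 0 < c ∧ ∃ p₀ : ℕ,
          ∀ p d m δ : ℕ, p₀ ≤ p → 1 ≤ d →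
            a * Real.log p ≤ (δ : ℝ) → (δ : ℝ) ≤ b * Real.log p →
            C * Real.sqrt ((d : ℝ) * (p : ℝ)) * Real.log p ≤ (m : ℝ) →
            ∀ adj : Sketching.EdgeChoice p m δ → Matrix (Fin m) (Fin p) ℝ,
              (adj = Sketching.countMatrix ∨ adj = Sketching.zeroOneMatrix) →
              ∀ X : Matrix (Fin p) (Fin p) ℝ, Sketching.IsDistributedSparse d X →
                1 - (p : ℝ) ^ (-c) <
                    ((Sketching.edgeLaw p m δ).prod (Sketching.edgeLaw p m δ)).real
                      {J | Sketching.NoisyRecovery ε (adj J.1) (adj J.2) X} ∧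
                1 - (p : ℝ) ^ (-c) <
                    (Sketching.edgeLaw p m δ).real
                      {J | Sketching.NoisyRecovery ε (adj J) (adj J) X} := by
  refine ⟨1 / 8, by norm_num, by norm_num, fun a b ha hab => ?_⟩
  have hb : 0 < b := ha.trans_le hab
  set ρ : ℝ := Real.exp (-4 / a) with hρdef
  have hρ : 0 < ρ := Real.exp_pos _
  have hρ1 : ρ ≤ 1 := Real.exp_le_one_iff.2 (div_nonpos_of_nonpos_of_nonneg (by norm_num) ha.le)
  -- The threshold 9 serves `failure_lt`; `exp (40 / a)` forces `δ ≥ 40`, the value of `N` in the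
  -- collision bounds.
  refine ⟨7 * b / (ρ / 2) ^ 40, 1, by positivity, one_pos, max 9 ⌈Real.exp (40 / a)⌉₊, ?_⟩
  intro p d m δ hp hd hδa hδb hm adj hadj X hX
  have hp9 : 9 ≤ p := (le_max_left _ _).trans hp
  have hp0 : (0 : ℝ) < p := by exact_mod_cast (by omega : 0 < p)
  have hδ : 40 ≤ δ := by
    have h1 : Real.exp (40 / a) ≤ p := Nat.ceil_le.1 ((le_max_right _ _).trans hp)
    have h2 : 40 / a ≤ Real.log p := (Real.le_log_iff_exp_le hp0).2 h1
    rw [div_le_iff₀ ha] at h2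
    exact_mod_cast (by linarith : (40 : ℝ) ≤ δ)
  obtain ⟨hm0, h1, h2⟩ := Sketching.density_bounds hb (by positivity : 0 < (ρ / 2) ^ 40)
    (by omega) hd hδb hm
  have hfail := Sketching.failure_lt ha hp9 hδa
  have := Sketching.isProbabilityMeasure_edgeLaw (p := p) (δ := δ) hm0
  constructor
  · refine lt_of_lt_of_le (sub_lt_sub_left hfail 1) (Sketching.Rare.le_real ?_ ?_)
    · rintro ⟨J, J'⟩
      rw [← Set.singleton_prod_singleton, measureReal_prod_prod,
        Sketching.edgeLaw_real_singleton hm0, Sketching.edgeLaw_real_singleton hm0, Nat.card_prod,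
        Nat.cast_mul, mul_inv]
    · exact Sketching.Rare.of_equiv (Sketching.sumEdgeChoiceEquiv p m δ)
        (Sketching.rare_not_noisyRecovery hδ hm0 hρ hρ1 Sum.inl_injective Sum.inr_injective hadj
          hX.min h1 h2)
  · exact lt_of_lt_of_le (sub_lt_sub_left hfail 1)
      (Sketching.Rare.le_real (Sketching.edgeLaw_real_singleton hm0)
        (Sketching.rare_not_noisyRecovery hδ hm0 hρ hρ1 Function.injective_id
          Function.injective_id hadj hX.min h1 h2))
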